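/- Let $X$ be a complex Banach space and let $T$ be a bounded linear operator on $X$ with spectral radius and operator norm $r(T)=\|T\|=1$ and with $\ker(T-I)\neq\{0\}$. An operator is called Weyl if it is Fredholm of index $0$, and Browder if it is Fredholm with finite ascent and finite descent. Suppose that $T$ is quasi-compact, i.e. its essential spectral radius $\sup\{|\lambda| : T-\lambda I \text{ is not Weyl}\}$ (with $\sup\emptyset=0$) is less than $1$, and that the peripheral spectrum $\sigma_{per}(T)=\{\lambda\in\sigma(T): |\lambda|=r(T)\}$ is finite and cyclic, i.e. if $r u\in\sigma_{per}(T)$ with $r\ge 0$ and $|u|=1$, then $r u^{j}\in\sigma_{per}(T)$ for all $j\in\mathbb Z$. Then there is an integer $k\ge 1$ such that $T^k-I$ is a Browder operator and, with $p$ the ascent of $T^k-I$, i.e. the least integer $q\ge 0$ with $\ker(T^k-I)^q=\ker(T^k-I)^{q+1}$, the following holds. The spaces $\ker(T^k-I)^p\subset X$ and $\ker((T^k)^*-I)^p\subset X^*$ have the same finite dimension $n$; for all bases $e_1,\dots,e_n$ of the former and $e_1^*,\dots,e_n^*$ of the latter, the Gram matrix $G=(e_i^*(e_j))_{i,j=1}^n$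 is invertible, and with $(a_{ij})=G^{-1}$ the operator $$Px=\sum_{i=1}^n\sum_{j=1}^n a_{ij}\,e_j^*(x)\,e_i,\qquad x\in X,$$ is a compact projection of $X$ onto $\ker(T^k-I)^p$, and $$\lim_{m\to\infty}\|T^{km}-P\|=0.$$ -/

import Mathlib

open Filter Topology
open scoped ENNReal NNReal

noncomputable section

namespace OperatorIterates

variable {X : Type*} [NormedAddCommGroup X] [NormedSpace ℂ X]

/-- The adjoint (Banach-space dual) operator `T* : X* → X*`, `T* x* = x* ∘ T`. -/
def adjointOp (T : X →L[ℂ] X) : StrongDual ℂ X →L[ℂ] StrongDual ℂ X :=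
  ContinuousLinearMap.precomp ℂ T

/-- Finite ascent: the chain `ker S ^ k` becomes stationary at some step. -/
def HasFiniteAscent (S : X →L[ℂ] X) : Prop :=
  ∃ k : ℕ, (S ^ k).ker = (S ^ (k + 1)).ker

/-- Finite descent: the chain `im S ^ k` becomes stationary at some step. -/
def HasFiniteDescent (S : X →L[ℂ] X) : Prop :=
  ∃ k : ℕ, (S ^ k).range = (S ^ (k + 1)).range

/-- The ascent of `S`: the least `k` with `ker S ^ k = ker S ^ (k + 1)`
(meaningful only for operators with finite ascent). -/
def ascent (S : X →L[ℂ] X) : ℕ :=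
  sInf {k : ℕ | (S ^ k).ker = (S ^ (k + 1)).ker}

/-- A Weyl operator: a Fredholm operator of index `0`. -/
def IsWeyl (S : X →L[ℂ] X) : Prop :=
  S.IsFredholm ∧ (S : X →ₗ[ℂ] X).index = 0

/-- A Browder operator: a Fredholm operator with finite chain length,
that is, with finite ascent and finite descent. -/
def IsBrowder (S : X →L[ℂ] X) : Prop :=
  S.IsFredholm ∧ HasFiniteAscent S ∧ HasFiniteDescent S

/-- The essential (Weyl) spectrum: all `z` such that `T - z I` is not a Weyl operator. -/
def essentialSpectrum (T : X →L[ℂ] X) : Set ℂ :=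
  {z : ℂ | ¬ IsWeyl (T - z • (1 : X →L[ℂ] X))}

/-- The essential spectral radius, the supremum of the moduli over the essential spectrum
(in `[0, ∞]`, so that it is `0` if the essential spectrum is empty). -/
def essentialSpectralRadius (T : X →L[ℂ] X) : ℝ≥0∞ :=
  ⨆ z ∈ essentialSpectrum T, (‖z‖₊ : ℝ≥0∞)

/-- `T` is quasi-compact: its essential spectral radius is less than one. -/
def IsQuasiCompact (T : X →L[ℂ] X) : Prop :=
  essentialSpectralRadius T < 1

/-- The peripheral spectrum: the spectral values whose modulus is the spectral radius. -/
def peripheralSpectrum (T : X →L[ℂ] X) : Set ℂ :=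
  {z ∈ spectrum ℂ T | (‖z‖₊ : ℝ≥0∞) = spectralRadius ℂ T}

/-- A set of complex numbers is cyclic if with `z = |z| u`, `|u| = 1`, it contains `|z| u ^ j`
for all integers `j`. -/
def IsCyclicSet (A : Set ℂ) : Prop :=
  ∀ r : ℝ, 0 ≤ r → ∀ u : ℂ, ‖u‖ = 1 → (r : ℂ) * u ∈ A → ∀ j : ℤ, (r : ℂ) * u ^ j ∈ A

/-- The Gram matrix `G i j = f i (e j)` of functionals `f` acting on vectors `e`. -/
def gramMatrix {n : ℕ} (e : Fin n → X) (f : Fin n → StrongDual ℂ X) :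
    Matrix (Fin n) (Fin n) ℂ :=
  Matrix.of fun i j => f i (e j)

/-- The operator `P x = ∑ i, ∑ j, a i j * f j (x) • e i`, where `(a i j)` is the inverse of the
Gram matrix of `e` and `f`. -/
def gramProjection {n : ℕ} (e : Fin n → X) (f : Fin n → StrongDual ℂ X) : X →L[ℂ] X :=
  ∑ i, ∑ j, (gramMatrix e f)⁻¹ i j • (f j).smulRight (e i)

end OperatorIterates

end

noncomputable section

namespace OperatorIterates

variable {X : Type*} [NormedAddCommGroup X] [NormedSpace ℂ X]

/-! ### Weyl operators and roots of unity -/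

section Weyl

/-! A finite cyclic peripheral spectrum consists of roots of unity, so for some `k` the contraction
`U = T ^ k` has no spectral value of modulus at least `1` other than `1`. Quasi-compactness makes `U
- 1` Weyl. Boundedness of the powers of `U` excludes Jordan chains of length two at `1`, and index
zero upgrades this to `X = ker (U - 1) ⊕ range (U - 1)` (`isCompl_ker_range`); the ascent is
therefore `1`. With `P` the projection of this splitting, `U - P` has spectral radius below `1` and
`(U - P) ^ m = U ^ m - P` for `m ≥ 1`, whence convergence. Functionals fixed by the adjoint vanish
on the range, so they form the dual of `ker (U - 1)`. This perfect pairing makes the Gram matrix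
invertible and identifies the Gram formula with `P`. -/

theorem isWeyl_one : IsWeyl (1 : X →L[ℂ] X) := by
  refine ⟨ContinuousLinearMap.IsFredholm.of_isQuasiInverse (v := 1)
    (ContinuousLinearEquiv.refl ℂ X).toLinearEquiv.isQuasiInverse, ?_⟩
  exact LinearMap.index_id

theorem IsWeyl.mul {R S : X →L[ℂ] X} (hR : IsWeyl R) (hS : IsWeyl S) : IsWeyl (R * S) := by
  obtain ⟨v, hv⟩ := hR.1.exists_isQuasiInverse
  obtain ⟨w, hw⟩ := hS.1.exists_isQuasiInverse
  refine ⟨ContinuousLinearMap.IsFredholm.of_isQuasiInverse (v := w ∘L v) (hw.comp hv), ?_⟩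
  have := hR.1.finite_ker
  have := hS.1.finite_ker
  have : FiniteDimensional ℂ (X ⧸ R.range) := hR.1.finite_coker
  have : FiniteDimensional ℂ (X ⧸ S.range) := hS.1.finite_coker
  have h := LinearMap.index_comp (f := (S : X →ₗ[ℂ] X)) (R : X →ₗ[ℂ] X)
  rw [hR.2, hS.2, add_zero] at h
  exact h

theorem isWeyl_aeval_prod (T : X →L[ℂ] X) (s : Finset ℂ)
    (h : ∀ z ∈ s, IsWeyl (T - z • (1 : X →L[ℂ] X))) :
    IsWeyl (Polynomial.aeval T (∏ z ∈ s, (Polynomial.X - Polynomial.C z))) := by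
  classical
  induction s using Finset.induction_on with
  | empty => simpa using isWeyl_one
  | insert a s ha ih =>
    rw [Finset.prod_insert ha, map_mul]
    refine IsWeyl.mul ?_ (ih fun z hz => h z (Finset.mem_insert_of_mem hz))
    simpa [Algebra.algebraMap_eq_smul_one] using h a (Finset.mem_insert_self a s)

theorem IsQuasiCompact.isWeyl_sub_smul {T : X →L[ℂ] X} (hT : IsQuasiCompact T) {z : ℂ}
    (hz : ‖z‖ = 1) : IsWeyl (T - z • (1 : X →L[ℂ] X)) := by
  by_contra h
  have h1 : (‖z‖₊ : ℝ≥0∞) ≤ essentialSpectralRadius T :=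
    le_iSup₂ (f := fun (z : ℂ) (_ : z ∈ essentialSpectrum T) => (‖z‖₊ : ℝ≥0∞)) z h
  have h2 : ‖z‖₊ = 1 := NNReal.eq hz
  rw [h2, ENNReal.coe_one] at h1
  exact (h1.trans_lt hT).false

/-- `X ^ k - 1` is the product of `X - z` over the `k`-th roots of unity, and each factor `T - z` is
Weyl because `‖z‖ = 1`. -/
theorem IsQuasiCompact.isWeyl_pow_sub_one {T : X →L[ℂ] X} (hT : IsQuasiCompact T) {k : ℕ}
    (hk : 0 < k) : IsWeyl (T ^ k - 1) := by
  have h := isWeyl_aeval_prod T (Polynomial.nthRootsFinset k (1 : ℂ)) fun z hz =>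
    hT.isWeyl_sub_smul
      (Complex.norm_eq_one_of_pow_eq_one ((Polynomial.mem_nthRootsFinset hk 1).1 hz) hk.ne')
  rw [← Polynomial.X_pow_sub_one_eq_prod hk (Complex.isPrimitiveRoot_exp k hk.ne')] at h
  simpa using h

end Weyl

/-! ### Finite cyclic sets -/

section Cyclic

/-- A finite cyclic set of unimodular numbers consists of `k`-th roots of unity for some `k`. -/
theorem exists_forall_pow_eq_one {A : Set ℂ} (hfin : A.Finite) (hcyc : IsCyclicSet A)
    (hA : ∀ z ∈ A, ‖z‖ = 1) : ∃ k : ℕ, 0 < k ∧ ∀ z ∈ A, z ^ k = 1 := by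
  have hord : ∀ z ∈ A, IsOfFinOrder z := by
    intro z hz
    have hmem : ∀ j : ℕ, z ^ j ∈ A := fun j => by
      simpa using hcyc 1 zero_le_one z (hA z hz) (by simpa using hz) j
    obtain ⟨i, -, j, -, hij, heq⟩ :=
      Set.infinite_univ.exists_lt_map_eq_of_mapsTo (f := fun j : ℕ => z ^ j)
        (fun j _ => hmem j) hfin
    have hz0 : z ≠ 0 := norm_ne_zero_iff.1 (by rw [hA z hz]; exact one_ne_zero)
    refine isOfFinOrder_iff_pow_eq_one.2 ⟨j - i, Nat.sub_pos_of_lt hij, ?_⟩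
    have heq' : z ^ i = z ^ j := heq
    rw [pow_sub₀ z hz0 hij.le, ← heq', mul_inv_cancel₀ (pow_ne_zero i hz0)]
  -- The product of the orders is a common multiple of them.
  refine ⟨∏ z ∈ hfin.toFinset, orderOf z, Finset.prod_pos fun z hz =>
    (hord z (hfin.mem_toFinset.1 hz)).orderOf_pos, fun z hz => ?_⟩
  exact orderOf_dvd_iff_pow_eq_one.1 (Finset.dvd_prod_of_mem _ (hfin.mem_toFinset.2 hz))

end Cyclic

/-! ### Kernel and range of `U - 1` for a contraction -/

section Contraction

/-- For a contraction `U`, the kernel of `U - 1` meets the range of `U - 1` trivially. -/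
theorem sub_one_apply_eq_zero_of_sq {U : X →L[ℂ] X} (hU : ‖U‖ ≤ 1) {x : X}
    (hx : (U - 1) ((U - 1) x) = 0) : (U - 1) x = 0 := by
  set y := (U - 1) x with hy
  have hUy : U y = y := by simpa [sub_eq_zero] using hx
  have hUx : U x = x + y := by simp [hy]
  -- Linear growth along a Jordan chain: as `‖U ^ m x‖ ≤ ‖x‖`, it forces `m * ‖y‖ ≤ 2 * ‖x‖` for all
  -- `m`, hence `y = 0`.
  have hiter : ∀ m : ℕ, (U ^ m) x = x + (m : ℂ) • y := by
    intro m
    induction m with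
    | zero => simp
    | succ m ih =>
      rw [pow_succ', mul_apply_eq_comp, ih, map_add, map_smul, hUx, hUy]
      push_cast
      module
  have hpow : ∀ (m : ℕ) (v : X), ‖(U ^ m) v‖ ≤ ‖v‖ := by
    intro m v
    induction m with
    | zero => simp
    | succ m ih =>
      rw [pow_succ', mul_apply_eq_comp]
      exact ((U.le_of_opNorm_le hU _).trans_eq (one_mul _)).trans ih
  by_contra hne
  have hpos : 0 < ‖y‖ := norm_pos_iff.2 hne
  obtain ⟨m, hm⟩ := exists_nat_gt (2 * ‖x‖ / ‖y‖)
  rw [div_lt_iff₀ hpos] at hm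
  have h1 : (m : ℂ) • y = (U ^ m) x - x := by rw [hiter]; abel
  have h2 : (m : ℝ) * ‖y‖ = ‖(U ^ m) x - x‖ := by rw [← h1, norm_smul]; simp
  linarith [norm_sub_le ((U ^ m) x) x, hpow m x]

/-- Disjointness makes the map from the kernel to the quotient by the range injective; index zero
equates the dimensions, so it is onto, and kernel and range span. -/
theorem isCompl_ker_range {U : X →L[ℂ] X} (hU : ‖U‖ ≤ 1) (hW : IsWeyl (U - 1)) :
    IsCompl (U - 1).ker (U - 1).range := by
  have hdisj : Disjoint (U - 1).ker (U - 1).range := by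
    rw [Submodule.disjoint_def]
    rintro x hx ⟨y, rfl⟩
    exact sub_one_apply_eq_zero_of_sq hU hx
  refine ⟨hdisj, ?_⟩
  have := hW.1.finite_ker
  have : FiniteDimensional ℂ (X ⧸ (U - 1).range) := hW.1.finite_coker
  have hrank : Module.finrank ℂ (U - 1).ker = Module.finrank ℂ (X ⧸ (U - 1).range) := by
    have h := hW.2
    rw [LinearMap.index_eq_finrank_sub] at h
    exact_mod_cast sub_eq_zero.1 h
  set q : (U - 1).ker →ₗ[ℂ] X ⧸ (U - 1).range := (U - 1).range.mkQ ∘ₗ (U - 1).ker.subtype with hq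
  have hinj : Function.Injective q := by
    rw [injective_iff_map_eq_zero]
    intro x hx
    have hx' : (x : X) ∈ (U - 1).range := (Submodule.Quotient.mk_eq_zero _).1 hx
    exact Subtype.ext (Submodule.disjoint_def.1 hdisj x x.2 hx')
  have hsurj := (LinearMap.injective_iff_surjective_of_finrank_eq_finrank hrank).1 hinj
  rw [codisjoint_iff_le_sup]
  intro x _
  obtain ⟨y, hy⟩ := hsurj ((U - 1).range.mkQ x)
  have hxy : x - y ∈ (U - 1).range := (Submodule.Quotient.eq _).1 hy.symm
  exact Submodule.mem_sup.2 ⟨y, y.2, x - y, hxy, by abel⟩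

theorem ker_pow_one_eq_ker_pow_two {U : X →L[ℂ] X} (hU : ‖U‖ ≤ 1) :
    ((U - 1) ^ 1).ker = ((U - 1) ^ (1 + 1)).ker := by
  ext x
  constructor
  · intro hx
    have hx' : (U - 1) x = 0 := by rwa [pow_one] at hx
    change ((U - 1) ^ (1 + 1) : X →L[ℂ] X) x = 0
    rw [pow_succ, pow_one, mul_apply_eq_comp, hx', map_zero]
  · intro hx
    have hx' : ((U - 1) ^ (1 + 1) : X →L[ℂ] X) x = 0 := hx
    rw [pow_succ, pow_one, mul_apply_eq_comp] at hx'
    change ((U - 1) ^ 1 : X →L[ℂ] X) x = 0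
    rw [pow_one]
    exact sub_one_apply_eq_zero_of_sq hU hx'

theorem isBrowder_sub_one {U : X →L[ℂ] X} (hU : ‖U‖ ≤ 1) (hW : IsWeyl (U - 1)) :
    IsBrowder (U - 1) := by
  refine ⟨hW.1, ⟨1, ker_pow_one_eq_ker_pow_two hU⟩, 1, le_antisymm ?_ ?_⟩
  · rintro _ ⟨x, rfl⟩
    obtain ⟨a, ha, _, ⟨y, rfl⟩, rfl⟩ := Submodule.mem_sup.1
      ((isCompl_ker_range hU hW).codisjoint.top_le (Submodule.mem_top (x := x)))
    refine ⟨y, ?_⟩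
    have ha' : (U - 1) a = 0 := ha
    change ((U - 1) ^ (1 + 1) : X →L[ℂ] X) y = ((U - 1) ^ 1 : X →L[ℂ] X) (a + (U - 1) y)
    rw [pow_succ, pow_one, mul_apply_eq_comp, map_add, ha', zero_add]
  · rintro _ ⟨x, rfl⟩
    refine ⟨(U - 1) x, ?_⟩
    change ((U - 1) ^ 1 : X →L[ℂ] X) ((U - 1) x) = ((U - 1) ^ (1 + 1) : X →L[ℂ] X) x
    rw [pow_succ (U - 1) 1, mul_apply_eq_comp]

theorem ascent_sub_one {U : X →L[ℂ] X} (hU : ‖U‖ ≤ 1) (hker : (U - 1).ker ≠ ⊥) :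
    ascent (U - 1) = 1 := by
  have hmem : 1 ∈ {k : ℕ | ((U - 1) ^ k).ker = ((U - 1) ^ (k + 1)).ker} :=
    ker_pow_one_eq_ker_pow_two hU
  refine le_antisymm (Nat.sInf_le hmem) (Nat.one_le_iff_ne_zero.2 fun h0 => hker ?_)
  have h := Nat.sInf_mem ⟨1, hmem⟩
  change ((U - 1) ^ ascent (U - 1)).ker = ((U - 1) ^ (ascent (U - 1) + 1)).ker at h
  rw [h0, zero_add, pow_one, pow_zero] at h
  rw [← h]
  exact LinearMap.ker_id

end Contraction

/-! ### Convergence of the powers -/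

section SpectralRadius

/-- By Gelfand's formula, `‖a ^ m‖ ≤ r ^ m` eventually, for any `r` between the spectral radius and
`1`. -/
theorem tendsto_norm_pow_of_spectralRadius_lt_one {A : Type*} [NormedRing A] [NormedAlgebra ℂ A]
    [CompleteSpace A] {a : A} (ha : spectralRadius ℂ a < 1) :
    Tendsto (fun m : ℕ => ‖a ^ m‖) atTop (𝓝 0) := by
  obtain ⟨r, har, hr1⟩ := ENNReal.lt_iff_exists_nnreal_btwn.1 ha
  have hr : (r : ℝ) < 1 := by exact_mod_cast hr1
  refine squeeze_zero' (Eventually.of_forall fun _ => norm_nonneg _) ?_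
    (tendsto_pow_atTop_nhds_zero_of_lt_one r.2 hr)
  filter_upwards [(spectrum.pow_nnnorm_pow_one_div_tendsto_nhds_spectralRadius a).eventually_lt_const
    har, eventually_gt_atTop 0] with m hm hm0
  have hm0' : (0 : ℝ) < m := Nat.cast_pos.2 hm0
  have h := ENNReal.rpow_le_rpow hm.le hm0'.le
  rw [← ENNReal.rpow_mul, one_div_mul_cancel hm0'.ne', ENNReal.rpow_one, ENNReal.rpow_natCast] at h
  exact_mod_cast h

/-- If `P` is the projection onto `ker (U - 1)` along `range (U - 1)` and `1` is the only spectral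
value of `U` outside the open unit disc, then the powers of `U - P` tend to `0`. -/
theorem spectralRadius_sub_projection_lt_one [CompleteSpace X] [Nontrivial X] {U : X →L[ℂ] X}
    (hspec : ∀ z ∈ spectrum ℂ U, 1 ≤ ‖z‖ → z = 1)
    (hc : Submodule.IsTopCompl (U - 1).ker (U - 1).range) :
    spectralRadius ℂ (U - (U - 1).ker.projectionL (U - 1).range hc) < 1 := by
  set P := (U - 1).ker.projectionL (U - 1).range hc with hP
  have hfix : ∀ x, U (P x) = P x := fun x => by
    have h : (U - 1) (P x) = 0 := Submodule.projectionL_apply_mem hc x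
    simpa [sub_eq_zero] using h
  have hPS : ∀ x, P ((U - 1) x) = 0 := fun x =>
    (Submodule.projectionL_apply_eq_zero_iff hc).2 ⟨x, rfl⟩
  have hPU : ∀ x, P (U x) = P x := fun x => by
    have h := hPS x
    simpa [sub_eq_zero] using h
  have hPP : ∀ x, P (P x) = P x := fun x =>
    Submodule.projectionL_apply_left hc ⟨P x, Submodule.projectionL_apply_mem hc x⟩
  refine spectrum.spectralRadius_lt_of_forall_lt (r := 1) _ fun z hz => ?_
  by_contra hlt
  have hz1 : 1 ≤ ‖z‖ := by
    have := not_lt.1 hlt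
    exact_mod_cast this
  have hz0 : z ≠ 0 := norm_ne_zero_iff.1 (zero_lt_one.trans_le hz1).ne'
  refine hz ?_
  change IsUnit (algebraMap ℂ (X →L[ℂ] X) z - (U - P))
  rw [ContinuousLinearMap.isUnit_iff_bijective]
  have happ : ∀ x, (algebraMap ℂ (X →L[ℂ] X) z - (U - P)) x = z • x - U x + P x := fun x => by
    simp [Algebra.algebraMap_eq_smul_one]; abel
  -- Applying `P` decouples the equation `(z - U + P) x = y`: it gives `z • P x = P y`.
  have hPapp : ∀ x, P (z • x - U x + P x) = z • P x := fun x => by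
    simp [hPU, hPP]
  have hinjP : ∀ x, z • x - U x + P x = 0 → P x = 0 ∧ U x = z • x := fun x hx => by
    have h := hPapp x
    rw [hx, map_zero] at h
    have h' : P x = 0 := (smul_eq_zero.1 h.symm).resolve_left hz0
    rw [h', add_zero, sub_eq_zero] at hx
    exact ⟨h', hx.symm⟩
  by_cases h1 : z = 1
  · subst h1
    refine ⟨(injective_iff_map_eq_zero _).2 fun x hx => ?_, fun y => ?_⟩
    · rw [happ] at hx
      obtain ⟨hPx, hUx⟩ := hinjP x hx
      have hxk : x ∈ (U - 1).ker := by
        change (U - 1) x = 0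
        simp [hUx]
      have := Submodule.projectionL_apply_left hc ⟨x, hxk⟩
      exact this.symm.trans hPx
    · have hyr : P (y - P y) = 0 := by rw [map_sub, hPP, sub_self]
      obtain ⟨w, hw⟩ := (Submodule.projectionL_apply_eq_zero_iff hc).1 hyr
      have hw' : U w - w = y - P y := hw
      -- `1 - U + P` is the identity on the kernel and `1 - U` on the range, so the two components
      -- of `y` are solved separately.
      refine ⟨P y - (w - P w), ?_⟩
      rw [happ]
      simp only [map_sub, hfix, hPP, one_smul, sub_self, sub_zero]
      rw [← sub_add_cancel y (P y), ← hw']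
      simp only [map_add, map_sub, hPU, hPP]
      abel
  · have hu : IsUnit (algebraMap ℂ (X →L[ℂ] X) z - U) := by
      by_contra hn
      exact h1 (hspec z hn hz1)
    rw [ContinuousLinearMap.isUnit_iff_bijective] at hu
    have happ' : ∀ x, (algebraMap ℂ (X →L[ℂ] X) z - U) x = z • x - U x := fun x => by
      simp [Algebra.algebraMap_eq_smul_one]
    refine ⟨(injective_iff_map_eq_zero _).2 fun x hx => ?_, fun y => ?_⟩
    · rw [happ] at hx
      obtain ⟨-, hUx⟩ := hinjP x hx
      refine (injective_iff_map_eq_zero _).1 hu.1 x ?_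
      rw [happ', hUx, sub_self]
    · obtain ⟨w, hw⟩ := hu.2 (y - z⁻¹ • P y)
      rw [happ'] at hw
      have hPw : P w = z⁻¹ • P y := by
        have h := congrArg P hw
        simp only [map_sub, map_smul, hPU, hPP] at h
        have h' : (z - 1) • (P w - z⁻¹ • P y) = 0 := by
          rw [smul_sub, sub_smul, one_smul, h, sub_smul, smul_inv_smul₀ hz0, one_smul, sub_self]
        exact sub_eq_zero.1 ((smul_eq_zero.1 h').resolve_left (sub_ne_zero.2 h1))
      refine ⟨w, ?_⟩
      rw [happ, hw, hPw, sub_add_cancel]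

theorem tendsto_norm_pow_sub_projection [CompleteSpace X] [Nontrivial X] {U : X →L[ℂ] X}
    (hspec : ∀ z ∈ spectrum ℂ U, 1 ≤ ‖z‖ → z = 1)
    (hc : Submodule.IsTopCompl (U - 1).ker (U - 1).range) :
    Tendsto (fun m : ℕ => ‖U ^ m - (U - 1).ker.projectionL (U - 1).range hc‖) atTop (𝓝 0) := by
  have hlim := tendsto_norm_pow_of_spectralRadius_lt_one
    (spectralRadius_sub_projection_lt_one hspec hc)
  set P := (U - 1).ker.projectionL (U - 1).range hc with hP
  have hUP : U * P = P := by
    ext x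
    have h : (U - 1) (P x) = 0 := Submodule.projectionL_apply_mem hc x
    simpa [sub_eq_zero] using h
  have hPU : P * U = P := by
    ext x
    have h : P ((U - 1) x) = 0 := (Submodule.projectionL_apply_eq_zero_iff hc).2 ⟨x, rfl⟩
    simpa [sub_eq_zero] using h
  have hPP : P * P = P := Submodule.isIdempotentElem_projectionL hc
  have hUmP : ∀ m : ℕ, U ^ m * P = P := fun m => by
    induction m with
    | zero => rw [pow_zero, one_mul]
    | succ m ih => rw [pow_succ, mul_assoc, hUP, ih]
  -- The shift is needed: at exponent `0` the identity would read `1 = 1 - P`.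
  have hpow : ∀ m : ℕ, (U - P) ^ (m + 1) = U ^ (m + 1) - P := fun m => by
    induction m with
    | zero => simp
    | succ m ih =>
      rw [pow_succ, ih, sub_mul, mul_sub, mul_sub, hUmP, hPU, hPP, sub_self, sub_zero, ← pow_succ]
  rw [← tendsto_add_atTop_iff_nat 1] at hlim ⊢
  simpa only [hpow] using hlim

end SpectralRadius

/-! ### Duality and the Gram matrix -/

section Gram

theorem mem_ker_adjointOp_sub_one_iff {U : X →L[ℂ] X} {g : StrongDual ℂ X} :
    g ∈ (adjointOp U - 1).ker ↔ ∀ x, g ((U - 1) x) = 0 := by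
  have h : ∀ x, ((adjointOp U - 1) g) x = g ((U - 1) x) := fun x => by
    simp [adjointOp]
  constructor
  · intro hg x
    have hg' : (adjointOp U - 1) g = 0 := hg
    rw [← h, hg', zero_apply]
  · intro hg
    change (adjointOp U - 1) g = 0
    ext x
    rw [h, hg, zero_apply]

variable {U : X →L[ℂ] X}

theorem apply_projectionL_of_mem_ker_adjointOp
    (hc : Submodule.IsTopCompl (U - 1).ker (U - 1).range) {g : StrongDual ℂ X}
    (hg : g ∈ (adjointOp U - 1).ker) (x : X) :
    g ((U - 1).ker.projectionL (U - 1).range hc x) = g x := by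
  have h : (U - 1).ker.projectionL (U - 1).range hc
      (x - (U - 1).ker.projectionL (U - 1).range hc x) = 0 := by
    rw [map_sub, Submodule.projectionL_apply_left hc
      ⟨_, Submodule.projectionL_apply_mem hc x⟩, sub_self]
  obtain ⟨y, hy⟩ := (Submodule.projectionL_apply_eq_zero_iff hc).1 h
  have h2 := mem_ker_adjointOp_sub_one_iff.1 hg y
  have hy' : (U - 1) y = x - (U - 1).ker.projectionL (U - 1).range hc x := hy
  rw [hy', map_sub, sub_eq_zero] at h2
  exact h2.symm

/-- Functionals fixed by the adjoint correspond to functionals on the fixed space. -/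
def kerAdjointEquivDual [FiniteDimensional ℂ (U - 1).ker]
    (hc : Submodule.IsTopCompl (U - 1).ker (U - 1).range) :
    (adjointOp U - 1).ker ≃ₗ[ℂ] Module.Dual ℂ (U - 1).ker where
  toFun g := (g : StrongDual ℂ X).toLinearMap ∘ₗ (U - 1).ker.subtype
  map_add' _ _ := rfl
  map_smul' _ _ := rfl
  invFun φ := ⟨(LinearMap.toContinuousLinearMap φ) ∘L (U - 1).ker.projectionOntoL (U - 1).range hc,
    mem_ker_adjointOp_sub_one_iff.2 fun x => by
      have h : (U - 1).ker.projectionOntoL (U - 1).range hc ((U - 1) x) = 0 :=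
        (Submodule.projectionOntoL_apply_eq_zero_iff hc).2 ⟨x, rfl⟩
      rw [ContinuousLinearMap.comp_apply, h, map_zero]⟩
  left_inv g := by
    ext x
    exact apply_projectionL_of_mem_ker_adjointOp hc g.2 x
  right_inv φ := by
    ext x
    change φ ((U - 1).ker.projectionOntoL (U - 1).range hc x) = φ x
    rw [Submodule.projectionOntoL_apply_left]

/-- A null vector of the matrix gives a vector of the kernel killed by every fixed functional; these
restrict onto the whole dual, so it is zero. -/
theorem isUnit_gramMatrix [FiniteDimensional ℂ (U - 1).ker]
    (hc : Submodule.IsTopCompl (U - 1).ker (U - 1).range) {n : ℕ}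
    (e : Module.Basis (Fin n) ℂ (U - 1).ker)
    (f : Module.Basis (Fin n) ℂ (adjointOp U - 1).ker) :
    IsUnit (gramMatrix (fun i => (e i : X)) (fun i => (f i : StrongDual ℂ X))) := by
  rw [← Matrix.mulVec_injective_iff_isUnit]
  refine (injective_iff_map_eq_zero (Matrix.mulVecLin _)).2 fun v hv => ?_
  set x : (U - 1).ker := ∑ j, v j • e j with hx
  have hfx : ∀ i, (f i : StrongDual ℂ X) x = 0 := fun i => by
    have h := congrFun hv i
    have hv' : ∑ j, (f i : StrongDual ℂ X) (e j) * v j = 0 := h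
    simpa only [hx, Submodule.coe_sum, Submodule.coe_smul, map_sum, map_smul, smul_eq_mul,
      mul_comm] using hv'
  have hgx : ∀ g : (adjointOp U - 1).ker, (g : StrongDual ℂ X) x = 0 := fun g => by
    rw [← f.sum_repr g]
    simp only [Submodule.coe_sum, Submodule.coe_smul, FunLike.coe_sum, Finset.sum_apply,
      FunLike.coe_smul, Pi.smul_apply, hfx, smul_zero, Finset.sum_const_zero]
  have hx0 : x = 0 := (Module.forall_dual_apply_eq_zero_iff ℂ x).1 fun φ => by
    have h := hgx ((kerAdjointEquivDual hc).symm φ)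
    have h2 := LinearMap.congr_fun ((kerAdjointEquivDual hc).apply_symm_apply φ) x
    exact h2.symm.trans h
  exact funext (Fintype.linearIndependent_iff.1 e.linearIndependent v hx0)

/-- The Gram formula sees `x` only through the values `f j x`, which do not change when `x` is
projected to the kernel; there, inverting the Gram matrix reproduces each `e l`. -/
theorem gramProjection_eq_projectionL [FiniteDimensional ℂ (U - 1).ker]
    (hc : Submodule.IsTopCompl (U - 1).ker (U - 1).range) {n : ℕ}
    (e : Module.Basis (Fin n) ℂ (U - 1).ker)
    (f : Module.Basis (Fin n) ℂ (adjointOp U - 1).ker) :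
    gramProjection (fun i => (e i : X)) (fun i => (f i : StrongDual ℂ X)) =
      (U - 1).ker.projectionL (U - 1).range hc := by
  set G := gramMatrix (fun i => (e i : X)) (fun i => (f i : StrongDual ℂ X)) with hG
  have hdet : IsUnit G.det := (Matrix.isUnit_iff_isUnit_det _).1 (isUnit_gramMatrix hc e f)
  have happ : ∀ x, gramProjection (fun i => (e i : X)) (fun i => (f i : StrongDual ℂ X)) x =
      ∑ i, (∑ j, G⁻¹ i j * (f j : StrongDual ℂ X) x) • (e i : X) := fun x => by
    simp [gramProjection, hG, Finset.sum_smul, mul_smul]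
  have hbasis : ∀ l, ∑ i, (∑ j, G⁻¹ i j * (f j : StrongDual ℂ X) (e l)) • (e i : X) = e l :=
    fun l => by
      have h : ∀ i, ∑ j, G⁻¹ i j * (f j : StrongDual ℂ X) (e l) = (1 : Matrix _ _ ℂ) i l :=
        fun i => by
          rw [← Matrix.nonsing_inv_mul G hdet, Matrix.mul_apply]
          rfl
      simp only [h, Matrix.one_apply, ite_smul, one_smul, zero_smul, Finset.sum_ite_eq',
        Finset.mem_univ, if_true]
  have hbasis' : ∀ l, gramProjection (fun i => (e i : X)) (fun i => (f i : StrongDual ℂ X)) (e l) =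
      e l := fun l => (happ _).trans (hbasis l)
  have hker : ∀ y : (U - 1).ker,
      gramProjection (fun i => (e i : X)) (fun i => (f i : StrongDual ℂ X)) y = y := fun y => by
    rw [← e.sum_repr y]
    simp only [Submodule.coe_sum, Submodule.coe_smul, map_sum, map_smul, hbasis']
  ext x
  refine Eq.trans ?_ (hker ⟨_, Submodule.projectionL_apply_mem hc x⟩)
  rw [happ, happ]
  simp only [apply_projectionL_of_mem_ker_adjointOp hc (f _).2]

end Gram

theorem isCompactOperator_projectionL {K R : Submodule ℂ X} [FiniteDimensional ℂ K]
    (hc : Submodule.IsTopCompl K R) : IsCompactOperator (K.projectionL R hc) := by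
  have : ProperSpace K := FiniteDimensional.proper ℂ K
  have h : IsCompactOperator (K.projectionOntoL R hc) :=
    (isCompactOperator_id (E := K)).comp_clm (K.projectionOntoL R hc)
  exact h.clm_comp K.subtypeL

/-- By spectral mapping `z = w ^ k`; then `1 ≤ ‖w‖`, so `w` is peripheral. -/
theorem eq_one_of_mem_spectrum_pow [CompleteSpace X] [Nontrivial X] {T : X →L[ℂ] X}
    (hr : spectralRadius ℂ T = 1) {k : ℕ} (hk : 0 < k)
    (hper : ∀ z ∈ peripheralSpectrum T, z ^ k = 1) {z : ℂ} (hz : z ∈ spectrum ℂ (T ^ k))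
    (hz1 : 1 ≤ ‖z‖) : z = 1 := by
  rw [spectrum.map_pow] at hz
  obtain ⟨w, hw, rfl⟩ := hz
  refine hper w ⟨hw, le_antisymm
    (le_iSup₂ (f := fun (z : ℂ) (_ : z ∈ spectrum ℂ T) => (‖z‖₊ : ℝ≥0∞)) w hw) ?_⟩
  rw [hr]
  have : 1 ≤ ‖w‖ := by
    by_contra hlt
    simp only [norm_pow] at hz1
    exact absurd (pow_lt_one₀ (norm_nonneg w) (not_le.1 hlt) hk.ne') (not_lt.2 hz1)
  exact_mod_cast this

end OperatorIterates

end

theorem mainTheorem4 {X : Type*} [NormedAddCommGroup X] [NormedSpace ℂ X] [CompleteSpace X]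
    (T : X →L[ℂ] X)
    (hqc : OperatorIterates.IsQuasiCompact T)
    (hr : spectralRadius ℂ T = 1)
    (hT : ‖T‖ = 1)
    (hfix : (T - 1).ker ≠ ⊥)
    (hfin : (OperatorIterates.peripheralSpectrum T).Finite)
    (hcyc : OperatorIterates.IsCyclicSet (OperatorIterates.peripheralSpectrum T)) :
    ∃ k : ℕ, 0 < k ∧
      -- `T ^ k - I` is a Browder operator; below, `p` is its ascent
      OperatorIterates.IsBrowder (T ^ k - 1) ∧
      ∃ p : ℕ, p = OperatorIterates.ascent (T ^ k - 1) ∧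
        -- the two (generalized) eigenspaces have the same finite dimension
        FiniteDimensional ℂ ((T ^ k - 1) ^ p).ker ∧
        FiniteDimensional ℂ ((OperatorIterates.adjointOp (T ^ k) - 1) ^ p).ker ∧
        Module.finrank ℂ ((T ^ k - 1) ^ p).ker =
          Module.finrank ℂ ((OperatorIterates.adjointOp (T ^ k) - 1) ^ p).ker ∧
        -- for all bases of them, the Gram matrix is invertible, and the iterates converge to
        -- the compact projection built from its inverse
        ∀ (n : ℕ) (e : Module.Basis (Fin n) ℂ ((T ^ k - 1) ^ p).ker)
          (f : Module.Basis (Fin n) ℂ ((OperatorIterates.adjointOp (T ^ k) - 1) ^ p).ker)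
          (P : X →L[ℂ] X),
          P = OperatorIterates.gramProjection (fun i => (e i : X))
            (fun i => (f i : StrongDual ℂ X)) →
          IsUnit (OperatorIterates.gramMatrix (fun i => (e i : X))
            (fun i => (f i : StrongDual ℂ X))) ∧
          IsCompactOperator P ∧ IsIdempotentElem P ∧
          P.range = ((T ^ k - 1) ^ p).ker ∧
          Tendsto (fun m : ℕ => ‖T ^ (k * m) - P‖) atTop (𝓝 0) := by
  obtain ⟨k, hk, hper⟩ := OperatorIterates.exists_forall_pow_eq_one hfin hcyc fun z hz => by
    have h := hz.2
    rw [hr, ENNReal.coe_eq_one] at h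
    exact congrArg NNReal.toReal h
  have : Nontrivial X := by
    by_contra h
    rw [not_nontrivial_iff_subsingleton] at h
    exact hfix (Subsingleton.elim _ _)
  have hU : ‖T ^ k‖ ≤ 1 := (norm_pow_le T k).trans_eq (by rw [hT, one_pow])
  have hW := hqc.isWeyl_pow_sub_one hk
  have hker : (T ^ k - 1).ker ≠ ⊥ := fun h => hfix <| le_bot_iff.1 <| h ▸ fun x hx => by
    have hx' : T x = x := sub_eq_zero.1 (show T x - x = 0 from hx)
    change (T ^ k) x - x = 0
    rw [sub_eq_zero, FunLike.coe_pow_eq_iterate]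
    exact Function.iterate_fixed hx' k
  -- Both summands are closed, the range by the Fredholm property, so the projection is bounded.
  have hc := Submodule.IsCompl.isTopCompl_of_isClosed (OperatorIterates.isCompl_ker_range hU hW)
    (T ^ k - 1).isClosed_ker hW.1.isClosed_range
  have := hW.1.finite_ker
  refine ⟨k, hk, OperatorIterates.isBrowder_sub_one hU hW, 1, (OperatorIterates.ascent_sub_one hU hker).symm, ?_⟩
  rw [pow_one (T ^ k - 1), pow_one (OperatorIterates.adjointOp (T ^ k) - 1)]
  refine ⟨hW.1.finite_ker, (OperatorIterates.kerAdjointEquivDual hc).symm.finiteDimensional, ?_, ?_⟩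
  · rw [(OperatorIterates.kerAdjointEquivDual hc).finrank_eq, Subspace.dual_finrank_eq]
  · rintro n e f P rfl
    rw [OperatorIterates.gramProjection_eq_projectionL hc e f]
    refine ⟨OperatorIterates.isUnit_gramMatrix hc e f, OperatorIterates.isCompactOperator_projectionL hc,
      Submodule.isIdempotentElem_projectionL hc, Submodule.range_projectionL hc, ?_⟩
    simp only [pow_mul]
    exact OperatorIterates.tendsto_norm_pow_sub_projection
      (fun z hz hz1 => OperatorIterates.eq_one_of_mem_spectrum_pow hr hk hper hz hz1) hc
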